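/- Let $d\in\mathbb N$, $\beta_1,\beta_2>0$, let $f:[0,1]\to[0,\infty)$ be Riemann integrable, and let $p^*$ be a probability measure on $[0,\infty)^d$. For a partition $0=t_0<t_1<\dots<t_T=1$ put $\delta t_s=t_s-t_{s-1}$ and $\alpha_s=f(t_s)\,\delta t_s$. Let $x\sim p^*$, and given $x$ let the counts $y_{s,i}$ ($1\le s\le T$, $1\le i\le d$) be independent with $y_{s,i}\sim\mathrm{Pois}(g(t_s)\,\delta t_s\,x_i)$, where either (a) $g=f$, so that $y_s\mid x\sim\mathrm{Pois}(\alpha_s x)$ (the Gamma-Poisson observation model), or (b) $g\equiv 1$, so that $y_s\mid x\sim\mathrm{Pois}(x\,\delta t_s)$. Define the posterior-mean recursion by $\mu_0=\beta_1/\beta_2$ (in every coordinate) and $$\mu_s=\frac{\beta_2+\sum_{k=1}^{s-1}\alpha_k}{\beta_2+\sum_{k=1}^{s}\alpha_k}\,\mu_{s-1}+\frac{y_s}{\beta_2+\sum_{k=1}^{s}\alpha_k},\qquad 1\le s\le T,$$ and regard it as the path equal to $\mu_s$ on $[t_s,t_{s+1})$ and to $\mu_T$ at time $1$. Let $$A(t)=\Big(\beta_2+\int_0^t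 f(\tau)\,d\tau\Big)^{-1},\qquad L(t)=\beta_1A(t),$$ and let $N=(N(t))_{t\in[0,1]}$ be a $d$-dimensional Cox process with random base measure $x\,g(t)\,dt$, $x\sim p^*$: given $x$, its coordinates are independent Poisson processes with intensity measures $x_i\,g(t)\,dt$. (In case (b) the base measure is $x\,dt$; in case (a) it is $x f(t)\,dt$.) Then the stochastic differential equation $$d\mu(t)=\Big(L'(t)+\frac{A'(t)}{A(t)}\big(\mu(t)-L(t)\big)\Big)dt+A(t)\,dN(t),\qquad \mu(0)=\beta_1/\beta_2,$$ understood in integral form on $[0,1]$, has a solution with right-continuous paths with left limits, this solution is unique up to indistinguishability, and along every sequence of partitions with $\max_s\delta t_s\to0$ (hence $T\to\infty$) the paths of the recursion converge in distribution to it, in the Skorokhod space $D([0,1],\mathbb R^d)$ with the $J_1$ topology. -/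

import Mathlib

open MeasureTheory ProbabilityTheory Filter Topology Set
open scoped NNReal ENNReal unitInterval

noncomputable section

namespace GammaPoisson

/-! ### The Skorokhod space `D([0,1], E)` -/

/-- Right-continuous paths `[0,1] → E` with left limits. -/
@[ext]
structure SkorokhodSpace (E : Type*) [TopologicalSpace E] where
  /-- the underlying path -/
  toFun : I → E
  rightCts : ∀ t, ContinuousWithinAt toFun (Ici t) t
  leftLim : ∀ t, ∃ l, Tendsto toFun (𝓝[<] t) (𝓝 l)

instance (E : Type*) [TopologicalSpace E] : CoeFun (SkorokhodSpace E) (fun _ => I → E) :=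
  ⟨SkorokhodSpace.toFun⟩

/-- The cost of a time change `φ` (an increasing bijection of `[0,1]`):
`max (sup_t |φ t - t|) (sup_t dist (x t) (y (φ t)))`. -/
def j1Cost {E : Type*} [PseudoEMetricSpace E] (x y : I → E) (φ : I ≃o I) : ℝ≥0∞ :=
  max (⨆ t, edist (φ t) t) (⨆ t, edist (x t) (y (φ t)))

lemma j1Cost_refl {E : Type*} [PseudoEMetricSpace E] (x : I → E) :
    j1Cost x x (OrderIso.refl I) = 0 := by
  simp [j1Cost]

lemma j1Cost_symm {E : Type*} [PseudoEMetricSpace E] (x y : I → E) (φ : I ≃o I) :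
    j1Cost y x φ.symm ≤ j1Cost x y φ := by
  refine max_le_max (iSup_le fun t => ?_) (iSup_le fun t => ?_)
  · refine le_trans ?_ (le_iSup _ (φ.symm t))
    simp [edist_comm]
  · refine le_trans ?_ (le_iSup _ (φ.symm t))
    simp [edist_comm]

lemma j1Cost_trans {E : Type*} [PseudoEMetricSpace E] (x y z : I → E) (φ τ : I ≃o I) :
    j1Cost x z (φ.trans τ) ≤ j1Cost x y φ + j1Cost y z τ := by
  refine max_le (iSup_le fun t => ?_) (iSup_le fun t => ?_)
  · calc edist ((φ.trans τ) t) t ≤ edist (τ (φ t)) (φ t) + edist (φ t) t := edist_triangle _ _ _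
      _ ≤ j1Cost y z τ + j1Cost x y φ :=
        add_le_add ((le_iSup (fun s => edist (τ s) s) (φ t)).trans (le_max_left _ _))
          ((le_iSup (fun s => edist (φ s) s) t).trans (le_max_left _ _))
      _ = _ := add_comm _ _
  · calc edist (x t) (z ((φ.trans τ) t))
        ≤ edist (x t) (y (φ t)) + edist (y (φ t)) (z (τ (φ t))) := edist_triangle _ _ _
      _ ≤ _ :=
        add_le_add ((le_iSup (fun s => edist (x s) (y (φ s))) t).trans (le_max_right _ _))
          ((le_iSup (fun s => edist (y s) (z (τ s))) (φ t)).trans (le_max_right _ _))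

/-- The Skorokhod `J₁` distance: the infimum of the cost over all time changes. -/
instance (E : Type*) [PseudoEMetricSpace E] : PseudoEMetricSpace (SkorokhodSpace E) where
  edist x y := ⨅ φ : I ≃o I, j1Cost x y φ
  edist_self x := le_antisymm ((iInf_le _ (OrderIso.refl I)).trans (j1Cost_refl _).le) bot_le
  edist_comm x y := le_antisymm
    (le_iInf fun φ => (iInf_le _ φ.symm).trans (j1Cost_symm _ _ φ))
    (le_iInf fun φ => (iInf_le _ φ.symm).trans (j1Cost_symm _ _ φ))
  edist_triangle x y z := ENNReal.le_iInf_add_iInf fun φ τ =>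
    (iInf_le _ (φ.trans τ)).trans (j1Cost_trans _ _ _ φ τ)

instance (E : Type*) [PseudoEMetricSpace E] : MeasurableSpace (SkorokhodSpace E) := borel _

instance (E : Type*) [PseudoEMetricSpace E] : BorelSpace (SkorokhodSpace E) := ⟨rfl⟩

/-! ### Partitions of the unit interval -/

/-- A partition `0 = t₀ < t₁ < ⋯ < t_T = 1`. -/
structure UnitPartition where
  /-- the number of steps -/
  T : ℕ
  /-- the partition points (only the values at `0, …, T` matter) -/
  pt : ℕ → I
  pt_zero : pt 0 = 0
  pt_last : pt T = 1
  strictMonoOn : StrictMonoOn pt (Iic T)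

namespace UnitPartition

/-- The step length `t_{s+1} - t_s`. -/
def δ (π : UnitPartition) (s : ℕ) : ℝ≥0 := ((π.pt (s + 1) : ℝ) - π.pt s).toNNReal

/-- The largest step length. -/
def mesh (π : UnitPartition) : ℝ≥0 := (Finset.range π.T).sup π.δ

/-- The index `s` with `t_s ≤ u < t_{s+1}` (and `T` for `u = 1`). -/
def index (π : UnitPartition) (u : I) : ℕ := by
  classical exact Nat.findGreatest (fun s => π.pt s ≤ u) π.T

lemma index_congr (π : UnitPartition) {u v : I}
    (h : ∀ s ∈ Finset.range (π.T + 1), (π.pt s ≤ v ↔ π.pt s ≤ u)) : π.index v = π.index u := by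
  classical
  unfold index
  have key : ∀ n ≤ π.T, Nat.findGreatest (fun s => π.pt s ≤ v) n
      = Nat.findGreatest (fun s => π.pt s ≤ u) n := by
    intro n
    induction n with
    | zero => simp
    | succ n ih =>
      intro hn
      rw [Nat.findGreatest_succ, Nat.findGreatest_succ, ih (by omega)]
      have := h (n + 1) (by simp; omega)
      simp only [this]
  convert key π.T le_rfl

/-- The piecewise constant path with value `m s` on `[t_s, t_{s+1})` and `m T` at `1`. -/
def stepPath {E : Type*} [TopologicalSpace E] (π : UnitPartition) (m : ℕ → E) :
    SkorokhodSpace E where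
  toFun u := m (π.index u)
  rightCts u := by
    have h : ∀ᶠ v in 𝓝[≥] u, ∀ s ∈ Finset.range (π.T + 1), (π.pt s ≤ v ↔ π.pt s ≤ u) := by
      rw [Filter.eventually_all_finset]
      intro s _
      by_cases hs : π.pt s ≤ u
      · filter_upwards [self_mem_nhdsWithin] with v hv
        exact iff_of_true (hs.trans hv) hs
      · have : ∀ᶠ v in 𝓝[≥] u, v < π.pt s :=
          mem_nhdsWithin_of_mem_nhds (Iio_mem_nhds (not_le.1 hs))
        filter_upwards [this] with v hv
        exact iff_of_false (not_le.2 hv) hs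
    refine tendsto_const_nhds.congr' ?_
    filter_upwards [h] with v hv
    rw [π.index_congr hv]
  leftLim u := by
    have h : ∀ᶠ v in 𝓝[<] u, ∀ s ∈ Finset.range (π.T + 1), (π.pt s ≤ v ↔ π.pt s < u) := by
      rw [Filter.eventually_all_finset]
      intro s _
      by_cases hs : π.pt s < u
      · have : ∀ᶠ v in 𝓝[<] u, π.pt s < v := mem_nhdsWithin_of_mem_nhds (Ioi_mem_nhds hs)
        filter_upwards [this] with v hv
        exact iff_of_true hv.le hs
      · filter_upwards [self_mem_nhdsWithin] with v hv
        exact iff_of_false (fun h' => hs (h'.trans_lt hv)) hs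
    rcases (𝓝[<] u).eq_or_neBot with hb | hb
    · exact ⟨m 0, by rw [hb]; exact tendsto_bot⟩
    · obtain ⟨w, hw⟩ := h.exists
      refine ⟨m (π.index w), tendsto_const_nhds.congr' ?_⟩
      filter_upwards [h] with v hv
      rw [π.index_congr (u := w) (v := v) fun s hs => (hv s hs).trans (hw s hs).symm]

end UnitPartition

/-! ### Conditionally independent Poisson variables, Cox processes -/

/-- Given `X`, the variables `Z j` (`j` in a finite set) are independent, and `Z j` is
Poisson distributed with rate `rate j X`. -/
def CondPoisson {Ω S J : Type*} [MeasurableSpace Ω] [MeasurableSpace S] [Fintype J]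
    (P : Measure Ω) (X : Ω → S) (Z : J → Ω → ℕ) (rate : J → S → ℝ≥0) : Prop :=
  ∀ B : Set S, MeasurableSet B → ∀ k : J → ℕ,
    P (X ⁻¹' B ∩ {ω | ∀ j, Z j ω = k j}) =
      ∫⁻ ω in X ⁻¹' B, ∏ j, poissonMeasure (rate j (X ω)) {k j} ∂P

/-- A counting path: an integer valued, nondecreasing, right-continuous path on `[0,1]`
which starts at `0`. -/
structure CountingPath where
  /-- the underlying path -/
  toFun : I → ℕ
  mono : Monotone toFun
  rightCts : ∀ t, ContinuousWithinAt toFun (Ici t) t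
  zero : toFun 0 = 0

instance : CoeFun CountingPath (fun _ => I → ℕ) := ⟨CountingPath.toFun⟩

/-- The Lebesgue-Stieltjes measure `dn` of a counting path `n`. -/
def CountingPath.measure (n : CountingPath) : Measure I :=
  StieltjesFunction.measure
    { toFun := fun t => (n t : ℝ)
      mono' := fun _ _ h => Nat.cast_le.2 (n.mono h)
      right_continuous' := fun t =>
        (continuous_of_discreteTopology (f := fun k : ℕ => (k : ℝ))).continuousAt.comp_continuousWithinAt
          (n.rightCts t) }

/-- `N` is a `d`-dimensional Cox process on `[0,1]` with random base measure `X g(t) dt`: given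
`X`, its coordinates are independent Poisson processes, the `i`-th one with intensity measure
`X i * g(t) dt`. -/
structure IsCoxProcess {Ω : Type*} [MeasurableSpace Ω] {d : ℕ} (P : Measure Ω)
    (X : Ω → Fin d → ℝ≥0) (g : ℝ → ℝ≥0) (N : Ω → Fin d → CountingPath) : Prop where
  measurable_X : Measurable X
  measurable_N : ∀ i t, Measurable fun ω => N ω i t
  increments : ∀ (m : ℕ) (s : Fin (m + 1) → I), Monotone s →
    CondPoisson P X
      (fun (j : Fin m × Fin d) ω => N ω j.2 (s j.1.succ) - N ω j.2 (s j.1.castSucc))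
      (fun j x => x j.2 *
        (∫ τ in (s j.1.castSucc : ℝ)..(s j.1.succ : ℝ), (g τ : ℝ)).toNNReal)

/-! ### The Gamma-Poisson posterior mean -/

/-- The posterior-mean recursion started at the prior mean `β₁ / β₂`; step `s` (counted from `0`)
uses the weight `α s` and the observation `y s`:
`μ_{s+1} = (β₂ + ∑_{k<s} α k) / (β₂ + ∑_{k≤s} α k) * μ_s + y s / (β₂ + ∑_{k≤s} α k)`. -/
def posteriorMean {d : ℕ} (β₁ β₂ : ℝ) (α : ℕ → ℝ≥0) (y : ℕ → Fin d → ℕ) : ℕ → Fin d → ℝ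
  | 0 => fun _ => β₁ / β₂
  | s + 1 => fun i =>
      (β₂ + ∑ k ∈ Finset.range s, (α k : ℝ)) / (β₂ + ∑ k ∈ Finset.range (s + 1), (α k : ℝ))
          * posteriorMean β₁ β₂ α y s i
        + (y s i : ℝ) / (β₂ + ∑ k ∈ Finset.range (s + 1), (α k : ℝ))

/-- The schedule `h(t_{s+1}) δt_{s+1}` of a function `h` along a partition. -/
def schedule (π : UnitPartition) (h : ℝ → ℝ≥0) (s : ℕ) : ℝ≥0 := h (π.pt (s + 1)) * π.δ s

/-- The observations along a partition: `X` has law `p`, and given `X` the counts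
`Y s i` (`s < T`, `i < d`) are independent and Poisson with rate `r s * X i`. -/
structure IsObservationModel {Ω : Type*} [MeasurableSpace Ω] {d : ℕ} (P : Measure Ω)
    (p : Measure (Fin d → ℝ≥0)) (T : ℕ) (r : ℕ → ℝ≥0)
    (X : Ω → Fin d → ℝ≥0) (Y : Ω → ℕ → Fin d → ℕ) : Prop where
  measurable_X : Measurable X
  law_X : P.map X = p
  measurable_Y : ∀ s < T, ∀ i, Measurable fun ω => Y ω s i
  cond : CondPoisson P X (fun (j : Fin T × Fin d) ω => Y ω j.1 j.2)
    (fun j x => r j.1 * x j.2)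

/-! ### The limiting equation -/

/-- Riemann integrability on `[0,1]`: bounded there, and continuous at almost every point. -/
def RiemannIntegrable (f : ℝ → ℝ≥0) : Prop :=
  (∃ C, ∀ t ∈ Icc (0 : ℝ) 1, f t ≤ C) ∧
    ∀ᵐ t ∂(volume.restrict (Icc (0 : ℝ) 1)), ContinuousWithinAt f (Icc 0 1) t

/-- `A(t) = (β₂ + ∫₀ᵗ f)⁻¹`. -/
def A (β₂ : ℝ) (f : ℝ → ℝ≥0) (t : ℝ) : ℝ := (β₂ + ∫ τ in (0 : ℝ)..t, (f τ : ℝ))⁻¹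

/-- `L(t) = β₁ (β₂ + ∫₀ᵗ f)⁻¹`. -/
def L (β₁ β₂ : ℝ) (f : ℝ → ℝ≥0) (t : ℝ) : ℝ := β₁ * (β₂ + ∫ τ in (0 : ℝ)..t, (f τ : ℝ))⁻¹

/-- The drift `L'(t) + A'(t) / A(t) * (m - L(t))`. -/
def drift (β₁ β₂ : ℝ) (f : ℝ → ℝ≥0) (t m : ℝ) : ℝ :=
  deriv (L β₁ β₂ f) t + deriv (A β₂ f) t / A β₂ f t * (m - L β₁ β₂ f t)

/-- The path `m` solves `dm = (L' + A'/A (m - L)) dt + A dn`, `m(0) = β₁ / β₂`, driven by the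
counting paths `n`: all integrals exist and, in every coordinate and for all `t ∈ [0,1]`,
`m(t) = β₁ / β₂ + ∫₀ᵗ drift(s, m(s)) ds + ∫_{(0,t]} A(s) dn(s)`. -/
def SolvesSDE {d : ℕ} (β₁ β₂ : ℝ) (f : ℝ → ℝ≥0) (n : Fin d → CountingPath)
    (m : SkorokhodSpace (Fin d → ℝ)) : Prop :=
  ∀ i,
    IntervalIntegrable (fun s => drift β₁ β₂ f s (m (projIcc 0 1 zero_le_one s) i)) volume 0 1 ∧
    Integrable (fun s : I => A β₂ f s) (n i).measure ∧
    ∀ t : I, m t i = β₁ / β₂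
      + (∫ s in (0 : ℝ)..t, drift β₁ β₂ f s (m (projIcc 0 1 zero_le_one s) i))
      + ∫ s in Ioc 0 t, A β₂ f s ∂(n i).measure

end GammaPoisson

end

namespace GammaPoisson

/-! ### Riemann integrable functions and the coefficients of the equation -/

section Coefficients

variable {f : ℝ → ℝ≥0} {β₁ β₂ : ℝ}

/-! Both the recursion and the equation become trivial after division by `A`. Multiplying the
recursion by its denominator makes it telescope: `μ_s = (β₁ + ∑ y_k) / (β₂ + ∑ α_k)`
(`posteriorMean_eq`). In the equation, `L = β₁ A` makes the two `L` terms of the drift cancel, and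
`A' = -f A²` a.e. leaves the drift `-f A m` (`ae_drift_eq`). So formally `d(m / A) = dN`, and the
solution is `A(t) (β₁ + N(t))`: integration by parts shows that it solves the equation
(`solution_solvesSDE`), and an integrating factor gives uniqueness, path by path
(`SolvesSDE.unique`).

For the convergence, the observations are replaced by the increments of `N` over the cells of the
partition. Given `x`, both families are independent Poisson variables, and their rates differ in
total by the error of a Riemann sum of `g` times `∑ x_i`. The total variation distance is therefore
at most `1 - exp(-error * ∑ x_i)`; its `p`-integral tends to zero by dominated convergence, without
any moment of `p` (`measure_increment_le`, `tendsto_lintegral_one_sub_exp`).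

The recursion fed with increments of `N` is the path `(β₁ + N(t_s)) / (β₂ + ∑ α_k)`, which converges
in `J₁` for each fixed counting path: a time change carries each of the finitely many jumps to the
next partition point, and the denominators are Riemann sums of `f` (`tendsto_stepPath_solution`).
Fatou's lemma and the open-set portmanteau criterion combine the two facts
(`tendstoInDistribution_of_le_add`). -/

lemma RiemannIntegrable.const (c : ℝ≥0) : RiemannIntegrable fun _ => c :=
  ⟨⟨c, fun _ _ => le_rfl⟩, ae_of_all _ fun _ => continuousWithinAt_const⟩

lemma RiemannIntegrable.ae_continuousAt (hf : RiemannIntegrable f) :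
    ∀ᵐ t ∂(volume.restrict (Ioo (0 : ℝ) 1)), ContinuousAt f t := by
  have h := ae_restrict_of_ae_restrict_of_subset Ioo_subset_Icc_self hf.2
  filter_upwards [h, ae_restrict_mem measurableSet_Ioo] with t ht hm
  exact ht.continuousAt (Icc_mem_nhds hm.1 hm.2)

/-- No measurability of `f` is assumed: it comes from the continuity set, which is a Gδ of full
measure in `(0,1)` and on which `f` is continuous. -/
lemma RiemannIntegrable.aestronglyMeasurable (hf : RiemannIntegrable f) :
    AEStronglyMeasurable (fun t => (f t : ℝ)) (volume.restrict (Ioo (0 : ℝ) 1)) := by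
  set C : Set ℝ := {t | ContinuousAt f t} with hC
  have hCm : MeasurableSet C := (IsGδ.setOfPred_continuousAt f).measurableSet
  have h1 : volume.restrict (Ioo (0 : ℝ) 1 ∩ C) = volume.restrict (Ioo (0 : ℝ) 1) := by
    refine Measure.restrict_congr_set ?_
    have := (ae_restrict_iff' measurableSet_Ioo).1 hf.ae_continuousAt
    filter_upwards [this] with t ht
    exact propext ⟨fun h => h.1, fun h => ⟨h, ht h⟩⟩
  rw [← h1]
  refine ContinuousOn.aestronglyMeasurable (fun t ht => ?_) (measurableSet_Ioo.inter hCm)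
  have : ContinuousAt f t := ht.2
  exact (NNReal.continuous_coe.continuousAt.comp this).continuousWithinAt

lemma RiemannIntegrable.intervalIntegrable (hf : RiemannIntegrable f) :
    IntervalIntegrable (fun t => (f t : ℝ)) volume 0 1 := by
  obtain ⟨⟨C, hC⟩, -⟩ := id hf
  rw [intervalIntegrable_iff_integrableOn_Ioo_of_le zero_le_one]
  refine Integrable.of_bound hf.aestronglyMeasurable (C : ℝ) ?_
  filter_upwards [ae_restrict_mem measurableSet_Ioo] with t ht
  simpa using hC t (Ioo_subset_Icc_self ht)

lemma RiemannIntegrable.intervalIntegrable_of_mem (hf : RiemannIntegrable f) {a b : ℝ}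
    (ha : a ∈ Icc (0 : ℝ) 1) (hb : b ∈ Icc (0 : ℝ) 1) :
    IntervalIntegrable (fun t => (f t : ℝ)) volume a b :=
  hf.intervalIntegrable.mono_set (by
    rw [uIcc_of_le zero_le_one]; exact uIcc_subset_Icc ha hb)

lemma RiemannIntegrable.integral_sub (hf : RiemannIntegrable f) {a b : ℝ}
    (ha : a ∈ Icc (0 : ℝ) 1) (hb : b ∈ Icc (0 : ℝ) 1) :
    (∫ τ in (0 : ℝ)..b, (f τ : ℝ)) - ∫ τ in (0 : ℝ)..a, (f τ : ℝ) = ∫ τ in a..b, (f τ : ℝ) :=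
  intervalIntegral.integral_interval_sub_left
    (hf.intervalIntegrable_of_mem (by simp) hb) (hf.intervalIntegrable_of_mem (by simp) ha)

lemma RiemannIntegrable.abs_integral_sub_le (hf : RiemannIntegrable f) {C : ℝ≥0}
    (hC : ∀ t ∈ Icc (0 : ℝ) 1, f t ≤ C) {a b : ℝ}
    (ha : a ∈ Icc (0 : ℝ) 1) (hb : b ∈ Icc (0 : ℝ) 1) :
    |(∫ τ in (0 : ℝ)..b, (f τ : ℝ)) - ∫ τ in (0 : ℝ)..a, (f τ : ℝ)| ≤ C * |b - a| := by
  rw [hf.integral_sub ha hb]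
  refine intervalIntegral.norm_integral_le_of_norm_le_const (f := fun τ => (f τ : ℝ))
    (C := (C : ℝ)) fun t ht => ?_
  have := hC t (uIcc_subset_Icc ha hb (uIoc_subset_uIcc ht))
  simpa using this

lemma integral_nonneg_of_mem {t : ℝ} (ht : t ∈ Icc (0 : ℝ) 1) :
    0 ≤ ∫ τ in (0 : ℝ)..t, (f τ : ℝ) :=
  intervalIntegral.integral_nonneg ht.1 fun _ _ => NNReal.coe_nonneg _

lemma abs_inv_sub_inv_le {b x y : ℝ} (hb : 0 < b) (hx : 0 ≤ x) (hy : 0 ≤ y) :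
    |(b + x)⁻¹ - (b + y)⁻¹| ≤ (b ^ 2)⁻¹ * |x - y| := by
  have h1 : 0 < b + x := by linarith
  have h2 : 0 < b + y := by linarith
  rw [inv_sub_inv h1.ne' h2.ne', abs_div, abs_of_pos (mul_pos h1 h2), ← div_eq_inv_mul,
    show b + y - (b + x) = -(x - y) by ring, abs_neg]
  refine div_le_div_of_nonneg_left (abs_nonneg _) (by positivity) ?_
  nlinarith

lemma A_pos (hβ₂ : 0 < β₂) {t : ℝ} (ht : t ∈ Icc (0 : ℝ) 1) : 0 < A β₂ f t := by
  have := integral_nonneg_of_mem (f := f) ht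
  unfold A; positivity

/-- `A` may fail to be differentiable on a null set; the Lipschitz bound makes it absolutely
continuous, so it is still the integral of its derivative. -/
lemma A_lipschitzOn (hβ₂ : 0 < β₂) (hf : RiemannIntegrable f) :
    ∃ K, LipschitzOnWith K (A β₂ f) (Icc 0 1) := by
  obtain ⟨C, hC⟩ := hf.1
  refine ⟨Real.toNNReal ((β₂ ^ 2)⁻¹) * C, LipschitzOnWith.of_dist_le_mul fun s hs t ht => ?_⟩
  rw [Real.dist_eq, Real.dist_eq, NNReal.coe_mul, Real.coe_toNNReal _ (by positivity), mul_assoc]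
  refine (abs_inv_sub_inv_le hβ₂ (integral_nonneg_of_mem hs) (integral_nonneg_of_mem ht)).trans ?_
  gcongr
  exact hf.abs_integral_sub_le hC ht hs

lemma continuousOn_A (hβ₂ : 0 < β₂) (hf : RiemannIntegrable f) :
    ContinuousOn (A β₂ f) (Icc 0 1) :=
  (A_lipschitzOn hβ₂ hf).choose_spec.continuousOn

lemma continuous_A_coe (hβ₂ : 0 < β₂) (hf : RiemannIntegrable f) :
    Continuous fun t : I => A β₂ f t :=
  continuousOn_iff_continuous_domRestrict.1 (continuousOn_A hβ₂ hf)

lemma ae_hasDerivAt_integral (hf : RiemannIntegrable f) :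
    ∀ᵐ t : ℝ, t ∈ Icc (0 : ℝ) 1 →
      HasDerivAt (fun t => ∫ τ in (0 : ℝ)..t, (f τ : ℝ)) (f t) t := by
  filter_upwards [hf.intervalIntegrable.ae_hasDerivAt_integral] with t ht hm
  rw [uIcc_of_le zero_le_one] at ht
  exact ht hm 0 (by simp)

lemma ae_hasDerivAt_A (hβ₂ : 0 < β₂) (hf : RiemannIntegrable f) :
    ∀ᵐ t : ℝ, t ∈ Icc (0 : ℝ) 1 → HasDerivAt (A β₂ f) (-(f t * A β₂ f t ^ 2)) t := by
  filter_upwards [ae_hasDerivAt_integral hf] with t ht hm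
  have h0 := A_pos (f := f) hβ₂ hm
  have hne : β₂ + ∫ τ in (0 : ℝ)..t, (f τ : ℝ) ≠ 0 := by
    have := integral_nonneg_of_mem (f := f) hm
    positivity
  convert! ((ht hm).const_add β₂).fun_inv hne using 1
  unfold A
  field_simp

/-- Since `L = β₁ A`, one has `L' = (A' / A) L`, so both `L` terms drop out, and `A' / A = -f A`. -/
lemma ae_drift_eq (hβ₂ : 0 < β₂) (hf : RiemannIntegrable f) :
    ∀ᵐ t : ℝ, t ∈ Icc (0 : ℝ) 1 → ∀ m, drift β₁ β₂ f t m = -(f t * A β₂ f t * m) := by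
  filter_upwards [ae_hasDerivAt_A hβ₂ hf] with t ht hm m
  have h0 := A_pos (f := f) hβ₂ hm
  have hL : L β₁ β₂ f = fun t => β₁ * A β₂ f t := rfl
  rw [drift, (ht hm).deriv, hL, ((ht hm).const_mul β₁).deriv]
  field_simp
  ring

lemma integral_mul_A_sq (hβ₂ : 0 < β₂) (hf : RiemannIntegrable f) {s t : ℝ} (hs : s ∈ Icc (0 : ℝ) 1)
    (ht : t ∈ Icc (0 : ℝ) 1) :
    ∫ u in s..t, f u * A β₂ f u ^ 2 = A β₂ f s - A β₂ f t := by
  obtain ⟨K, hK⟩ := A_lipschitzOn hβ₂ hf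
  have := (hK.mono (uIcc_subset_Icc hs ht)).absolutelyContinuousOnInterval.integral_deriv_eq_sub
  rw [← neg_sub, ← this, ← intervalIntegral.integral_neg]
  refine intervalIntegral.integral_congr_ae ?_
  filter_upwards [ae_hasDerivAt_A hβ₂ hf] with u hu hm
  rw [(hu (uIcc_subset_Icc hs ht (uIoc_subset_uIcc hm))).deriv]
  ring

lemma intervalIntegrable_mul_sq (hβ₂ : 0 < β₂) (hf : RiemannIntegrable f) :
    IntervalIntegrable (fun u => f u * A β₂ f u ^ 2) volume 0 1 :=
  hf.intervalIntegrable.mul_continuousOn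
    (by rw [uIcc_of_le zero_le_one]; exact (continuousOn_A hβ₂ hf).pow 2)

end Coefficients

/-! ### The explicit solution of the limiting equation -/

section Solution

variable {f : ℝ → ℝ≥0} {β₁ β₂ : ℝ}

instance (n : CountingPath) : IsFiniteMeasure n.measure := by
  unfold CountingPath.measure; infer_instance

lemma CountingPath.measureReal_Ioc (n : CountingPath) {a b : I} (h : a ≤ b) :
    n.measure.real (Ioc a b) = n b - n a := by
  rw [measureReal_def, CountingPath.measure, StieltjesFunction.measure_Ioc, ENNReal.toReal_ofReal]
  exact sub_nonneg.2 (Nat.cast_le.2 (n.mono h))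

/-- The càdlàg path `t ↦ A(t) (β₁ + n(t))`. -/
noncomputable def solution {d : ℕ} (β₁ : ℝ) (hβ₂ : 0 < β₂) (hf : RiemannIntegrable f)
    (n : Fin d → CountingPath) : SkorokhodSpace (Fin d → ℝ) where
  toFun t i := A β₂ f t * (β₁ + n i t)
  rightCts t := by
    refine continuousWithinAt_pi.2 fun i => ?_
    refine (continuous_A_coe hβ₂ hf).continuousWithinAt.mul (continuousWithinAt_const.add ?_)
    exact (continuous_of_discreteTopology (f := fun k : ℕ => (k : ℝ))).continuousAt
      |>.comp_continuousWithinAt ((n i).rightCts t)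
  leftLim t := by
    have h : ∀ i, ∃ l, Tendsto (fun t : I => A β₂ f t * (β₁ + n i t)) (𝓝[<] t) (𝓝 l) := by
      intro i
      have hm : Monotone fun t => (n i t : ℝ) := fun _ _ h => Nat.cast_le.2 ((n i).mono h)
      exact ⟨_, ((continuous_A_coe hβ₂ hf).continuousWithinAt (s := Iio t)).tendsto.mul
        (tendsto_const_nhds.add (hm.tendsto_leftLim t))⟩
    choose l hl using h
    exact ⟨l, tendsto_pi_nhds.2 hl⟩

/-- Integration by parts through Fubini: write `A s - A t` as the integral of `f A²` over `[s, t]`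
and swap the order over the region `s ≤ u`. The inner `dn`-integral is then `n u`, because `n 0 =
0`. -/
lemma setIntegral_A_counting (hβ₂ : 0 < β₂) (hf : RiemannIntegrable f) (n : CountingPath) (t : I) :
    ∫ s in Ioc 0 t, A β₂ f s ∂n.measure = A β₂ f t * n t
      + ∫ u in (0 : ℝ)..t, f u * A β₂ f u ^ 2 * n (projIcc 0 1 zero_le_one u) := by
  set k : ℝ → ℝ := fun u => f u * A β₂ f u ^ 2 with hk
  have hki : IntegrableOn k (Ioc 0 (t : ℝ)) := by
    refine ((intervalIntegrable_mul_sq hβ₂ hf).1).mono_set (Ioc_subset_Ioc_right t.2.2)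
  set R : Set (I × ℝ) := {q | (q.1 : ℝ) ≤ q.2} with hR
  have hRm : MeasurableSet R := measurableSet_le (by fun_prop) (by fun_prop)
  have hint : Integrable (Function.uncurry fun (s : I) (u : ℝ) => R.indicator (fun q => k q.2) (s, u))
      ((n.measure.restrict (Ioc 0 t)).prod (volume.restrict (Ioc 0 (t : ℝ)))) := by
    have : Integrable (fun q : I × ℝ => k q.2)
      ((n.measure.restrict (Ioc 0 t)).prod (volume.restrict (Ioc 0 (t : ℝ)))) :=
      Integrable.comp_snd hki _
    exact this.indicator hRm
  have hswap := integral_integral_swap hint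
  have h1 : ∀ s ∈ Ioc (0 : I) t, ∫ u in Ioc 0 (t : ℝ), R.indicator (fun q => k q.2) (s, u)
      = A β₂ f s - A β₂ f t := by
    intro s hs
    have hst : (s : ℝ) ≤ t := hs.2
    have e : (fun u => R.indicator (fun q => k q.2) (s, u)) = (Ici (s : ℝ)).indicator k := by
      ext u; simp [indicator, hR]
    rw [e, setIntegral_indicator measurableSet_Ici]
    have : Ioc 0 (t : ℝ) ∩ Ici (s : ℝ) = Icc (s : ℝ) t := by
      ext u
      have h0 : (0 : ℝ) < s := hs.1
      simp only [mem_inter_iff, mem_Ioc, mem_Ici, mem_Icc]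
      constructor
      · rintro ⟨⟨_, h⟩, h'⟩; exact ⟨h', h⟩
      · rintro ⟨h, h'⟩; exact ⟨⟨by linarith, h'⟩, h⟩
    rw [this, integral_Icc_eq_integral_Ioc, ← intervalIntegral.integral_of_le hst]
    exact integral_mul_A_sq hβ₂ hf s.2 t.2
  have h2 : ∀ u ∈ Ioc 0 (t : ℝ),
      ∫ s in Ioc 0 t, R.indicator (fun q => k q.2) (s, u) ∂n.measure
        = k u * n (projIcc 0 1 zero_le_one u) := by
    intro u hu
    have hu1 : u ∈ Icc (0 : ℝ) 1 := ⟨hu.1.le, hu.2.trans t.2.2⟩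
    have e : (fun s : I => R.indicator (fun q => k q.2) (s, u))
        = (Iic (⟨u, hu1⟩ : I)).indicator fun _ => k u := by
      ext s; simp [indicator, hR, ← Subtype.coe_le_coe]
    rw [e, setIntegral_indicator measurableSet_Iic, projIcc_of_mem _ hu1]
    have : Ioc (0 : I) t ∩ Iic ⟨u, hu1⟩ = Ioc 0 ⟨u, hu1⟩ := by
      rw [Ioc_inter_Iic]
      congr 1
      exact min_eq_right hu.2
    rw [this, setIntegral_const, n.measureReal_Ioc (show (0 : I) ≤ ⟨u, hu1⟩ from hu.1.le), n.zero,
      smul_eq_mul]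
    simp [mul_comm]
  rw [setIntegral_congr_fun measurableSet_Ioc h1, setIntegral_congr_fun measurableSet_Ioc h2,
    integral_sub, setIntegral_const, n.measureReal_Ioc t.2.1, n.zero] at hswap
  · rw [intervalIntegral.integral_of_le t.2.1, ← hswap]
    simp
    ring
  · exact ((continuous_A_coe hβ₂ hf).continuousOn.integrableOn_compact isCompact_univ).mono_set
      (subset_univ _)
  · exact integrable_const _

lemma solution_solvesSDE {d : ℕ} (hβ₂ : 0 < β₂) (hf : RiemannIntegrable f)
    (n : Fin d → CountingPath) : SolvesSDE β₁ β₂ f n (solution β₁ hβ₂ hf n) := by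
  intro i
  have hsub : ∀ t : I, uIoc (0 : ℝ) t ⊆ Icc 0 1 := fun t =>
    uIoc_subset_uIcc.trans (uIcc_subset_Icc (by simp) t.2)
  set q : ℝ → ℝ := fun u => f u * A β₂ f u ^ 2 * n i (projIcc 0 1 zero_le_one u) with hq
  have hdrift : ∀ t : I, ∀ᵐ s : ℝ, s ∈ uIoc (0 : ℝ) t →
      drift β₁ β₂ f s (solution β₁ hβ₂ hf n (projIcc 0 1 zero_le_one s) i)
        = -(β₁ * (f s * A β₂ f s ^ 2) + q s) := by
    intro t
    filter_upwards [ae_drift_eq (β₁ := β₁) hβ₂ hf] with s hs hm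
    have hm' := hsub t hm
    rw [hs hm']
    simp only [solution, hq, projIcc_of_mem _ hm']
    ring
  have hk := intervalIntegrable_mul_sq hβ₂ hf
  have hqi : IntervalIntegrable q volume 0 1 := by
    have hmono : Monotone fun u => (n i (projIcc 0 1 zero_le_one u) : ℝ) := fun _ _ h =>
      Nat.cast_le.2 ((n i).mono (monotone_projIcc _ h))
    rw [intervalIntegrable_iff] at hk ⊢
    refine Integrable.mul_bdd (c := (n i 1 : ℝ)) hk hmono.measurable.aestronglyMeasurable ?_
    refine ae_of_all _ fun u => ?_
    simpa using (n i).mono (projIcc 0 1 zero_le_one u).2.2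
  have hint := ((hk.const_mul β₁).add hqi).neg
  refine ⟨?_, ?_, fun t => ?_⟩
  · refine hint.congr_ae ?_
    rw [EventuallyEq, ae_restrict_iff' measurableSet_uIoc]
    filter_upwards [hdrift 1] with s hs hm
    rw [hs (by simpa using hm)]
    rfl
  · exact (continuous_A_coe hβ₂ hf).integrable_of_hasCompactSupport
      (HasCompactSupport.of_compactSpace _)
  -- The integral of `q` cancels against the one from integration by parts; the rest is `β₁ A(0) -
  -- β₁ (A(0) - A(t)) + A(t) n(t)`.
  · rw [intervalIntegral.integral_congr_ae (hdrift t), setIntegral_A_counting hβ₂ hf,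
      intervalIntegral.integral_neg, intervalIntegral.integral_add,
      intervalIntegral.integral_const_mul, integral_mul_A_sq hβ₂ hf (by simp) t.2]
    · have h0 : A β₂ f 0 = β₂⁻¹ := by simp [A]
      rw [h0]
      simp only [solution, hq]
      field_simp
      ring
    · exact (hk.const_mul β₁).mono_set
        (by rw [uIcc_of_le zero_le_one]; exact uIcc_subset_Icc (by simp) t.2)
    · exact hqi.mono_set
        (by rw [uIcc_of_le zero_le_one]; exact uIcc_subset_Icc (by simp) t.2)

/-- The `dn` integral cancels in the difference `H` of two solutions, leaving `H' = -f A H` a.e.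
With `G = 1 / A` as integrating factor, `H G` is absolutely continuous with zero derivative a.e.,
and it vanishes at `0`. -/
lemma SolvesSDE.unique {d : ℕ} (hβ₂ : 0 < β₂) (hf : RiemannIntegrable f)
    {n : Fin d → CountingPath} {m m' : SkorokhodSpace (Fin d → ℝ)}
    (hm : SolvesSDE β₁ β₂ f n m) (hm' : SolvesSDE β₁ β₂ f n m') : m = m' := by
  ext t i
  obtain ⟨h1, -, h2⟩ := hm i
  obtain ⟨h1', -, h2'⟩ := hm' i
  set p : ℝ → ℝ := fun s => drift β₁ β₂ f s (m (projIcc 0 1 zero_le_one s) i)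
  set p' : ℝ → ℝ := fun s => drift β₁ β₂ f s (m' (projIcc 0 1 zero_le_one s) i)
  set H : ℝ → ℝ := fun t => ∫ s in (0 : ℝ)..t, (p s - p' s) with hH
  set G : ℝ → ℝ := fun t => β₂ + ∫ τ in (0 : ℝ)..t, (f τ : ℝ) with hG
  have hsub : ∀ t : I, uIcc (0 : ℝ) t ⊆ uIcc 0 1 := fun t => by
    rw [uIcc_of_le zero_le_one]; exact uIcc_subset_Icc (by simp) t.2
  have hHeq : ∀ t : I, H t = m t i - m' t i := by
    intro t
    rw [h2 t, h2' t, hH]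
    simp only
    rw [intervalIntegral.integral_sub (h1.mono_set (hsub t)) (h1'.mono_set (hsub t))]
    ring
  have hHac : AbsolutelyContinuousOnInterval H 0 1 :=
    (h1.sub h1').absolutelyContinuousOnInterval_intervalIntegral (by simp)
  have hGac : AbsolutelyContinuousOnInterval G 0 1 := by
    obtain ⟨C, hC⟩ := hf.1
    refine (LipschitzOnWith.of_dist_le_mul (K := C) fun s hs t ht => ?_).absolutelyContinuousOnInterval
    rw [uIcc_of_le zero_le_one] at hs ht
    simpa [hG, Real.dist_eq] using hf.abs_integral_sub_le hC ht hs
  have hd : ∀ᵐ t : ℝ, t ∈ uIcc (0 : ℝ) 1 → HasDerivAt (fun t => H t * G t) 0 t := by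
    filter_upwards [ae_hasDerivAt_integral hf, ae_drift_eq (β₁ := β₁) hβ₂ hf,
      (h1.sub h1').ae_hasDerivAt_integral] with t hF hD hI hmem
    have hmem' := hmem
    rw [uIcc_of_le zero_le_one] at hmem'
    have hI' : HasDerivAt H (p t - p' t) t := hI hmem 0 (by simp)
    have key := hI'.mul ((hF hmem').const_add β₂)
    have hG0 : 0 < G t := by
      have := integral_nonneg_of_mem (f := f) hmem'
      simp only [hG]; positivity
    convert! key using 1
    have e1 : p t = -(f t * A β₂ f t * m ⟨t, hmem'⟩ i) := by
      simp only [p]; rw [hD hmem', projIcc_of_mem _ hmem']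
    have e2 : p' t = -(f t * A β₂ f t * m' ⟨t, hmem'⟩ i) := by
      simp only [p']; rw [hD hmem', projIcc_of_mem _ hmem']
    have e3 := hHeq ⟨t, hmem'⟩
    have e4 : A β₂ f t = (G t)⁻¹ := rfl
    simp only at e3
    change 0 = (p t - p' t) * G t + H t * f t
    rw [e1, e2, e3, e4]
    field_simp
    ring
  obtain ⟨c, hc⟩ := (hHac.fun_mul hGac).const_of_ae_hasDerivAt_zero hd
  have hc0 := hc 0 (by simp)
  have hct := hc t (by rw [uIcc_of_le zero_le_one]; exact t.2)
  have hG0 : G t ≠ 0 := by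
    have := integral_nonneg_of_mem (f := f) t.2
    simp only [hG]; positivity
  have : H 0 = 0 := by simp [hH]
  rw [this, zero_mul] at hc0
  rw [← hc0, hHeq] at hct
  exact sub_eq_zero.1 ((mul_eq_zero.1 hct).resolve_right hG0)

end Solution

end GammaPoisson

namespace GammaPoisson

/-! ### Partitions -/

namespace UnitPartition

variable (π : UnitPartition)

lemma index_le (u : I) : π.index u ≤ π.T := by
  classical
  exact Nat.findGreatest_le _

lemma pt_index_le (u : I) : π.pt (π.index u) ≤ u := by
  classical
  unfold index
  exact Nat.findGreatest_spec (P := fun s => π.pt s ≤ u) (m := 0) (Nat.zero_le _)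
    (by rw [π.pt_zero]; exact u.2.1)

lemma pt_le_pt {r s : ℕ} (h : r ≤ s) (hs : s ≤ π.T) : π.pt r ≤ π.pt s :=
  π.strictMonoOn.monotoneOn (show r ≤ π.T from h.trans hs) hs h

lemma pt_le_iff {s : ℕ} (hs : s ≤ π.T) (u : I) : π.pt s ≤ u ↔ s ≤ π.index u := by
  classical
  refine ⟨fun h => Nat.le_findGreatest hs h, fun h => ?_⟩
  exact (π.pt_le_pt h (π.index_le u)).trans (π.pt_index_le u)

lemma coe_δ {s : ℕ} (hs : s < π.T) : (π.δ s : ℝ) = π.pt (s + 1) - π.pt s := by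
  have : (π.pt s : ℝ) ≤ π.pt (s + 1) := π.pt_le_pt (Nat.le_succ s) hs
  rw [δ, Real.coe_toNNReal _ (by linarith)]

lemma pt_succ_sub_le {s : ℕ} (hs : s < π.T) : (π.pt (s + 1) : ℝ) - π.pt s ≤ π.mesh := by
  rw [← π.coe_δ hs]
  exact NNReal.coe_le_coe.2 (Finset.le_sup (Finset.mem_range.2 hs))

lemma sub_pt_index_le (u : I) : (u : ℝ) - π.pt (π.index u) ≤ π.mesh := by
  rcases (π.index_le u).eq_or_lt with h | h
  · rw [h, π.pt_last]
    have := u.2.2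
    have h0 : (0 : ℝ) ≤ π.mesh := NNReal.coe_nonneg _
    simp only [Icc.coe_one]; linarith
  · have h1 : ¬ π.pt (π.index u + 1) ≤ u := by
      rw [π.pt_le_iff h]; omega
    have h2 : (u : ℝ) < π.pt (π.index u + 1) := not_le.1 h1
    have := π.pt_succ_sub_le h
    linarith

/-- The index of the first partition point which is at least `u`. -/
noncomputable def upIndex (u : I) : ℕ := sInf {s | s ≤ π.T ∧ u ≤ π.pt s}

lemma upIndex_mem (u : I) : π.upIndex u ≤ π.T ∧ u ≤ π.pt (π.upIndex u) :=
  Nat.sInf_mem (s := {s | s ≤ π.T ∧ u ≤ π.pt s}) ⟨π.T, le_rfl, by rw [π.pt_last]; exact u.2.2⟩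

lemma upIndex_le_iff {s : ℕ} (hs : s ≤ π.T) (u : I) : π.upIndex u ≤ s ↔ u ≤ π.pt s :=
  ⟨fun h => (π.upIndex_mem u).2.trans (π.pt_le_pt h hs), fun h => Nat.sInf_le ⟨hs, h⟩⟩

lemma upIndex_mono : Monotone π.upIndex := fun u v h =>
  (π.upIndex_le_iff (π.upIndex_mem v).1 u).2 (h.trans (π.upIndex_mem v).2)

/-- Rounding up is adjoint to rounding down: a jump at `τ`, delayed to the grid, has occurred by
time `u` exactly when the last grid point before `u` has passed `τ`. -/
lemma pt_upIndex_le_iff (τ u : I) : π.pt (π.upIndex τ) ≤ u ↔ τ ≤ π.pt (π.index u) := by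
  rw [π.pt_le_iff (π.upIndex_mem τ).1, π.upIndex_le_iff (π.index_le u)]

lemma pt_upIndex_sub_le (u : I) : (π.pt (π.upIndex u) : ℝ) - u ≤ π.mesh := by
  have h0 : (0 : ℝ) ≤ π.mesh := NNReal.coe_nonneg _
  have hm := π.upIndex_mem u
  rcases h : π.upIndex u with _ | s
  · have := u.2.1
    rw [π.pt_zero]
    simp only [Icc.coe_zero]; linarith
  · have hs : s < π.T := by omega
    have h1 : ¬ u ≤ π.pt s := by
      rw [← π.upIndex_le_iff hs.le]; omega
    have h2 : (π.pt s : ℝ) < u := not_le.1 h1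
    have := π.pt_succ_sub_le hs
    linarith

lemma abs_pt_upIndex_sub_le (u : I) : |(π.pt (π.upIndex u) : ℝ) - u| ≤ π.mesh := by
  have h : (u : ℝ) ≤ π.pt (π.upIndex u) := (π.upIndex_mem u).2
  rw [abs_of_nonneg (sub_nonneg.2 h)]
  exact π.pt_upIndex_sub_le u

lemma upIndex_eq {s : ℕ} (hs : s < π.T) {u : I} (h : u ∈ Ioc (π.pt s) (π.pt (s + 1))) :
    π.upIndex u = s + 1 := by
  refine le_antisymm ((π.upIndex_le_iff hs u).2 h.2) ?_
  by_contra hlt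
  exact not_le.2 h.1 ((π.upIndex_le_iff hs.le u).1 (by omega))

lemma pt_upIndex_zero : π.pt (π.upIndex 0) = 0 := by
  have : π.upIndex 0 ≤ 0 := (π.upIndex_le_iff (Nat.zero_le _) 0).2 (by rw [π.pt_zero])
  rw [Nat.le_zero.1 this, π.pt_zero]

lemma pt_upIndex_one : π.pt (π.upIndex 1) = 1 :=
  le_antisymm (π.pt _).2.2 (π.upIndex_mem 1).2

end UnitPartition

/-! ### Riemann sums -/

section RiemannSums

variable {g : ℝ → ℝ≥0}

/-- The total deviation of the right-endpoint Riemann summands of `g` from its integrals over the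
cells of a partition. -/
noncomputable def riemannError (π : UnitPartition) (g : ℝ → ℝ≥0) : ℝ :=
  ∑ s ∈ Finset.range π.T,
    |(schedule π g s : ℝ) - ∫ τ in (π.pt s : ℝ)..π.pt (s + 1), (g τ : ℝ)|

lemma riemannError_nonneg (π : UnitPartition) : 0 ≤ riemannError π g :=
  Finset.sum_nonneg fun _ _ => abs_nonneg _

lemma abs_sum_schedule_sub_le (hg : RiemannIntegrable g) (π : UnitPartition) {s : ℕ}
    (hs : s ≤ π.T) :
    |∑ k ∈ Finset.range s, (schedule π g k : ℝ) - ∫ τ in (0 : ℝ)..π.pt s, (g τ : ℝ)|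
      ≤ riemannError π g := by
  have h := intervalIntegral.sum_integral_adjacent_intervals (f := fun τ => (g τ : ℝ))
    (μ := volume) (a := fun k => (π.pt k : ℝ)) (n := s)
    fun k _ => hg.intervalIntegrable_of_mem (π.pt k).2 (π.pt (k + 1)).2
  have h0 : (π.pt 0 : ℝ) = 0 := by rw [π.pt_zero]; rfl
  rw [h0] at h
  rw [← h, ← Finset.sum_sub_distrib]
  refine (Finset.abs_sum_le_sum_abs _ _).trans ?_
  exact Finset.sum_le_sum_of_subset_of_nonneg (Finset.range_subset_range.2 hs)
    fun _ _ _ => abs_nonneg _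

/-- The distance between `g` and its right-endpoint discretization. -/
noncomputable def discretizationGap (π : UnitPartition) (g : ℝ → ℝ≥0) (u : ℝ) : ℝ :=
  |(g (π.pt (π.upIndex (projIcc 0 1 zero_le_one u))) : ℝ) - g u|

lemma discretizationGap_le {C : ℝ≥0} (hC : ∀ t ∈ Icc (0 : ℝ) 1, g t ≤ C) (π : UnitPartition)
    {u : ℝ} (hu : u ∈ Icc (0 : ℝ) 1) : discretizationGap π g u ≤ C := by
  have h1 : (g u : ℝ) ≤ C := hC u hu
  have h2 : (g (π.pt (π.upIndex (projIcc 0 1 zero_le_one u))) : ℝ) ≤ C := hC _ (π.pt _).2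
  have h3 : (0 : ℝ) ≤ g u := NNReal.coe_nonneg _
  have h4 : (0 : ℝ) ≤ g (π.pt (π.upIndex (projIcc 0 1 zero_le_one u))) := NNReal.coe_nonneg _
  exact abs_le.2 ⟨by linarith, by linarith⟩

/-- The discretized `g` is a function of the monotone `ℕ`-valued index, hence measurable whatever
`g` is. -/
lemma aestronglyMeasurable_discretizationGap (hg : RiemannIntegrable g) (π : UnitPartition) :
    AEStronglyMeasurable (discretizationGap π g) (volume.restrict (uIoc (0 : ℝ) 1)) := by
  have h1 : Measurable fun u : ℝ => π.upIndex (projIcc 0 1 zero_le_one u) :=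
    (π.upIndex_mono.comp (monotone_projIcc _)).measurable
  have h2 : Measurable fun u : ℝ => (g (π.pt (π.upIndex (projIcc 0 1 zero_le_one u))) : ℝ) :=
    (measurable_of_countable fun s : ℕ => (g (π.pt s) : ℝ)).comp h1
  have h3 := (intervalIntegrable_iff.1 hg.intervalIntegrable).aestronglyMeasurable
  exact (h2.aestronglyMeasurable.sub h3).norm

lemma intervalIntegrable_discretizationGap (hg : RiemannIntegrable g) (π : UnitPartition) :
    IntervalIntegrable (discretizationGap π g) volume 0 1 := by
  obtain ⟨C, hC⟩ := hg.1
  rw [intervalIntegrable_iff]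
  have : IsFiniteMeasure (volume.restrict (uIoc (0 : ℝ) 1)) := by
    rw [uIoc_of_le zero_le_one]; infer_instance
  refine Integrable.of_bound (aestronglyMeasurable_discretizationGap hg π) (C : ℝ) ?_
  filter_upwards [ae_restrict_mem measurableSet_uIoc] with u hu
  rw [uIoc_of_le zero_le_one] at hu
  rw [Real.norm_of_nonneg (show 0 ≤ discretizationGap _ g u from abs_nonneg _)]
  exact discretizationGap_le hC π (Ioc_subset_Icc_self hu)

/-- On the cell `(t_s, t_{s+1}]` rounding up always gives `t_{s+1}`, so each summand is the absolute
value of an integral whose integrand has the gap as absolute value. -/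
lemma riemannError_le (hg : RiemannIntegrable g) (π : UnitPartition) :
    riemannError π g ≤ ∫ u in (0 : ℝ)..1, discretizationGap π g u := by
  have hi : ∀ k, IntervalIntegrable (discretizationGap π g) volume (π.pt k) (π.pt (k + 1)) :=
    fun k => (intervalIntegrable_discretizationGap hg π).mono_set
      (by rw [uIcc_of_le zero_le_one]; exact uIcc_subset_Icc (π.pt k).2 (π.pt (k + 1)).2)
  have h := intervalIntegral.sum_integral_adjacent_intervals (f := discretizationGap π g)
    (μ := volume) (a := fun k => (π.pt k : ℝ)) (n := π.T) fun k _ => hi k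
  have h0 : (π.pt 0 : ℝ) = 0 := by rw [π.pt_zero]; rfl
  have h1 : (π.pt π.T : ℝ) = 1 := by rw [π.pt_last]; rfl
  rw [h0, h1] at h
  rw [← h]
  refine Finset.sum_le_sum fun s hs => ?_
  have hs := Finset.mem_range.1 hs
  have hle : (π.pt s : ℝ) ≤ π.pt (s + 1) := π.pt_le_pt (Nat.le_succ s) hs
  have e : (schedule π g s : ℝ) - ∫ τ in (π.pt s : ℝ)..π.pt (s + 1), (g τ : ℝ)
      = ∫ τ in (π.pt s : ℝ)..π.pt (s + 1), ((g (π.pt (s + 1)) : ℝ) - g τ) := by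
    rw [intervalIntegral.integral_sub intervalIntegrable_const
      (hg.intervalIntegrable_of_mem (π.pt s).2 (π.pt (s + 1)).2), intervalIntegral.integral_const,
      schedule, NNReal.coe_mul, π.coe_δ hs, smul_eq_mul, mul_comm]
  rw [e]
  refine (intervalIntegral.abs_integral_le_integral_abs hle).trans (le_of_eq ?_)
  refine intervalIntegral.integral_congr_ae (ae_of_all _ fun u hu => ?_)
  rw [uIoc_of_le hle] at hu
  have hu1 : u ∈ Icc (0 : ℝ) 1 := ⟨(π.pt s).2.1.trans hu.1.le, hu.2.trans (π.pt (s + 1)).2.2⟩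
  rw [discretizationGap, projIcc_of_mem _ hu1, π.upIndex_eq hs (u := ⟨u, hu1⟩) hu]

/-- Dominated convergence: the rounded-up points tend to `u` within `[0,1]`, so the gap vanishes at
each continuity point of `g`, and it is bounded by the bound of `g`. -/
lemma tendsto_riemannError (hg : RiemannIntegrable g) {π : ℕ → UnitPartition}
    (hπ : Tendsto (fun n => (π n).mesh) atTop (𝓝 0)) :
    Tendsto (fun n => riemannError (π n) g) atTop (𝓝 0) := by
  obtain ⟨C, hC⟩ := hg.1
  have hlim : Tendsto (fun n => ∫ u in (0 : ℝ)..1, discretizationGap (π n) g u) atTop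
      (𝓝 (∫ _ in (0 : ℝ)..1, (0 : ℝ))) := by
    refine intervalIntegral.tendsto_integral_filter_of_dominated_convergence (fun _ => (C : ℝ))
      (.of_forall fun n => aestronglyMeasurable_discretizationGap hg _)
      (.of_forall fun n => ae_of_all _ fun u hu => ?_) intervalIntegrable_const ?_
    · rw [uIoc_of_le zero_le_one] at hu
      rw [Real.norm_of_nonneg (show 0 ≤ discretizationGap _ g u from abs_nonneg _)]
      exact discretizationGap_le hC _ (Ioc_subset_Icc_self hu)
    · have := (ae_restrict_iff' measurableSet_Icc).1 hg.2
      filter_upwards [this] with u hu hm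
      rw [uIoc_of_le zero_le_one] at hm
      have hm' := Ioc_subset_Icc_self hm
      have hpt : Tendsto (fun n => ((π n).pt ((π n).upIndex ⟨u, hm'⟩) : ℝ)) atTop
          (𝓝[Icc 0 1] u) := by
        refine tendsto_nhdsWithin_iff.2 ⟨?_, .of_forall fun n => Subtype.prop _⟩
        rw [tendsto_iff_dist_tendsto_zero]
        refine squeeze_zero (fun _ => dist_nonneg) (fun n => (π n).abs_pt_upIndex_sub_le ⟨u, hm'⟩) ?_
        exact NNReal.tendsto_coe.2 hπ
      have h2 := (NNReal.continuous_coe.tendsto _).comp ((hu hm').tendsto.comp hpt)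
      have h3 := (h2.sub_const (g u : ℝ)).abs
      rw [sub_self, abs_zero] at h3
      refine h3.congr fun n => ?_
      simp [discretizationGap, projIcc_of_mem _ hm']
  rw [intervalIntegral.integral_zero] at hlim
  exact squeeze_zero (fun n => riemannError_nonneg _) (fun n => riemannError_le hg _) hlim

end RiemannSums

/-! ### Time changes and `J₁` convergence -/

/-- A tent function of height `1` and slopes `± r⁻¹` centred at `a`. -/
noncomputable def tent (r a t : ℝ) : ℝ := max 0 (1 - |t - a| / r)

lemma abs_tent_sub_le {r : ℝ} (hr : 0 < r) (a s t : ℝ) :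
    |tent r a t - tent r a s| ≤ |t - s| / r := by
  unfold tent
  rw [max_comm 0, max_comm 0]
  refine (abs_max_sub_max_le_abs _ _ _).trans ?_
  rw [show 1 - |t - a| / r - (1 - |s - a| / r) = (|s - a| - |t - a|) / r by ring, abs_div,
    abs_of_pos hr]
  refine div_le_div_of_nonneg_right ?_ hr.le
  have h := abs_abs_sub_abs_le (s - a) (t - a)
  rwa [sub_sub_sub_cancel_right, abs_sub_comm s t] at h

lemma tent_nonneg (r a t : ℝ) : 0 ≤ tent r a t := le_max_left (0 : ℝ) _

lemma tent_le_one {r : ℝ} (hr : 0 < r) (a t : ℝ) : tent r a t ≤ 1 :=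
  max_le zero_le_one (by have : 0 ≤ |t - a| / r := by positivity
                         linarith)

lemma tent_self (r a : ℝ) : tent r a a = 1 := by simp [tent]

lemma tent_eq_zero {r : ℝ} (hr : 0 < r) {a t : ℝ} (h : r ≤ |t - a|) : tent r a t = 0 := by
  refine max_eq_left ?_
  have : 1 ≤ |t - a| / r := (one_le_div hr).2 h
  linarith

/-- Small displacements of finitely many points of `[0,1]`, fixing the end points, extend to
time changes which are uniformly close to the identity. -/
lemma exists_orderIso_of_displacement (D : Finset I) {ε : ℝ} (hε : 0 < ε) :
    ∃ η > 0, ∀ ρ : I → I, ρ 0 = 0 → ρ 1 = 1 → (∀ τ, |(ρ τ : ℝ) - τ| ≤ η) →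
      ∃ φ : I ≃o I, (∀ τ ∈ D, φ τ = ρ τ) ∧ ∀ t, |(φ t : ℝ) - t| ≤ ε := by
  classical
  set E : Finset I := insert 0 (insert 1 D) with hE
  -- Including `0` and `1` makes the minimal separation `r` positive and forces the interpolation to
  -- fix the end points.
  have hnt : (E : Set I).Nontrivial := ⟨0, by simp [hE], 1, by simp [hE], zero_ne_one⟩
  set r : ℝ := (E : Set I).infsep
  have hr : 0 < r := (E.finite_toSet.infsep_pos_iff_nontrivial).2 hnt
  have hsep : ∀ a ∈ E, ∀ b ∈ E, a ≠ b → r ≤ |(b : ℝ) - a| := fun a ha b hb hab => by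
    have := infsep_le_dist_of_mem (s := (E : Set I)) hb ha hab.symm
    rwa [Subtype.dist_eq, Real.dist_eq] at this
  -- The extra `1` gives the strict bound `E.card * η < r`, hence total slope of the perturbation
  -- below `1`, which keeps `ψ` strictly increasing.
  set K : ℝ := E.card + 1 with hK
  have hKpos : 0 < K := by positivity
  refine ⟨min r ε / K, by positivity, fun ρ h0 h1 hρ => ?_⟩
  set η := min r ε / K with hη
  have hηpos : 0 < η := by positivity
  have hηr : E.card * η < r := by
    have : K * η ≤ r := by rw [hη, mul_div_cancel₀ _ hKpos.ne']; exact min_le_left _ _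
    nlinarith
  have hηε : E.card * η ≤ ε := by
    have : K * η ≤ ε := by rw [hη, mul_div_cancel₀ _ hKpos.ne']; exact min_le_right _ _
    nlinarith
  -- At a point of `E` only its own tent is nonzero, since the tents have radius `r`; so `ψ`
  -- interpolates `ρ` there.
  set ψ : ℝ → ℝ := fun t => t + ∑ τ ∈ E, ((ρ τ : ℝ) - τ) * tent r τ t with hψ
  have hval : ∀ a ∈ E, ψ a = ρ a := by
    intro a ha
    have : ∑ τ ∈ E, ((ρ τ : ℝ) - τ) * tent r τ a = (ρ a : ℝ) - a := by
      rw [Finset.sum_eq_single a, tent_self, mul_one]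
      · intro b hb hba
        rw [tent_eq_zero hr (hsep b hb a ha hba), mul_zero]
      · exact fun h => absurd ha h
    simp only [hψ, this]; ring
  have hsmono : StrictMono ψ := by
    intro s t hst
    have hb : |∑ τ ∈ E, (((ρ τ : ℝ) - τ) * tent r τ t - ((ρ τ : ℝ) - τ) * tent r τ s)|
        ≤ E.card * (η * ((t - s) / r)) := by
      rw [← nsmul_eq_mul]
      refine (Finset.abs_sum_le_sum_abs _ _).trans (Finset.sum_le_card_nsmul _ _ _ fun τ _ => ?_)
      rw [← mul_sub, abs_mul]
      have := abs_tent_sub_le hr τ s t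
      rw [abs_of_pos (sub_pos.2 hst)] at this
      exact mul_le_mul (hρ τ) this (abs_nonneg _) hηpos.le
    rw [Finset.sum_sub_distrib] at hb
    have h2 : E.card * (η * ((t - s) / r)) < t - s := by
      rw [show E.card * (η * ((t - s) / r)) = (E.card * η / r) * (t - s) by ring]
      have h3 : E.card * η / r < 1 := (div_lt_one hr).2 hηr
      nlinarith [sub_pos.2 hst]
    have h4 := (abs_le.1 hb).1
    simp only [hψ]; linarith
  have hcont : Continuous ψ := by
    simp only [hψ, tent]; fun_prop
  have hψ0 : ψ 0 = 0 := by simpa [h0] using hval 0 (by simp [hE])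
  have hψ1 : ψ 1 = 1 := by simpa [h1] using hval 1 (by simp [hE])
  have hmem : ∀ t : I, ψ t ∈ Icc (0 : ℝ) 1 := fun t =>
    ⟨hψ0 ▸ hsmono.monotone t.2.1, (hsmono.monotone t.2.2).trans_eq hψ1⟩
  have hsurj : Function.Surjective fun t : I => (⟨ψ t, hmem t⟩ : I) := by
    intro y
    obtain ⟨t, ht, hty⟩ := intermediate_value_Icc zero_le_one hcont.continuousOn
      (show (y : ℝ) ∈ Icc (ψ 0) (ψ 1) by rw [hψ0, hψ1]; exact y.2)
    exact ⟨⟨t, ht⟩, Subtype.ext hty⟩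
  refine ⟨StrictMono.orderIsoOfSurjective (fun t : I => (⟨ψ t, hmem t⟩ : I))
    (fun s t h => hsmono h) hsurj, fun τ hτ => Subtype.ext (hval τ (by simp [hE, hτ])), fun t => ?_⟩
  change |ψ t - t| ≤ ε
  refine le_trans ?_ hηε
  simp only [hψ, add_sub_cancel_left]
  rw [← nsmul_eq_mul]
  refine (Finset.abs_sum_le_sum_abs _ _).trans (Finset.sum_le_card_nsmul _ _ _ fun τ _ => ?_)
  rw [abs_mul, abs_of_nonneg (tent_nonneg _ _ _)]
  have := mul_le_mul (hρ τ) (tent_le_one hr τ t) (tent_nonneg _ _ _) hηpos.le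
  simpa using this

/-- A counting path has finitely many jumps, and its values are determined by the jumps passed. -/
lemma CountingPath.exists_jumps (n : CountingPath) :
    ∃ D : Finset I, ∀ v w : I, (∀ τ ∈ D, (τ ≤ v ↔ τ ≤ w)) → n v = n w := by
  classical
  -- The time at which level `k` is reached. Right-continuity and discreteness of the values make
  -- the infimum attained for `k ≤ n 1`.
  set τ : ℕ → I := fun k => sInf {t | k ≤ n t} with hτ
  have key : ∀ k ≤ n 1, ∀ t, τ k ≤ t ↔ k ≤ n t := by
    intro k hk t
    refine ⟨fun h => le_trans ?_ (n.mono h), fun h => sInf_le h⟩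
    have hfreq : ∃ᶠ x in 𝓝[≥] (τ k), x ∈ {t | k ≤ n t} :=
      (isGLB_sInf {t | k ≤ n t}).frequently_mem ⟨1, hk⟩
    have hev : ∀ᶠ x in 𝓝[≥] (τ k), n x = n (τ k) :=
      (n.rightCts (τ k)).eventually (by simp [nhds_discrete] : ∀ᶠ y in 𝓝 (n (τ k)), y = n (τ k))
    obtain ⟨x, hx, hx'⟩ := (hfreq.and_eventually hev).exists
    exact hx' ▸ hx
  refine ⟨(Finset.range (n 1 + 1)).image τ, fun v w h => ?_⟩
  have hk : ∀ k ≤ n 1, (k ≤ n v ↔ k ≤ n w) := fun k hk => by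
    rw [← key k hk, ← key k hk]
    exact h _ (Finset.mem_image_of_mem _ (Finset.mem_range.2 (by omega)))
  have hv : n v ≤ n 1 := n.mono v.2.2
  have hw : n w ≤ n 1 := n.mono w.2.2
  exact le_antisymm ((hk _ hv).1 le_rfl) ((hk _ hw).2 le_rfl)

/-- The discretized posterior mean converges in `J₁` to the solution of the limiting equation,
path by path. -/
lemma tendsto_stepPath_solution {d : ℕ} {f : ℝ → ℝ≥0} {β₁ β₂ : ℝ} (hβ₁ : 0 < β₁) (hβ₂ : 0 < β₂)
    (hf : RiemannIntegrable f) {π : ℕ → UnitPartition}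
    (hπ : Tendsto (fun n => (π n).mesh) atTop (𝓝 0)) (n : Fin d → CountingPath) :
    Tendsto (fun k => (π k).stepPath fun s i =>
        (β₁ + n i ((π k).pt s)) / (β₂ + ∑ j ∈ Finset.range s, (schedule (π k) f j : ℝ)))
      atTop (𝓝 (solution β₁ hβ₂ hf n)) := by
  classical
  obtain ⟨C, hC⟩ := hf.1
  choose D hD using fun i => (n i).exists_jumps
  set M : ℝ := ∑ i, (n i 1 : ℝ) with hM
  have hM0 : 0 ≤ M := by positivity
  set B : ℝ := (β₁ + M) * (β₂ ^ 2)⁻¹ with hB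
  have hB0 : 0 < B := by positivity
  rw [EMetric.tendsto_atTop]
  intro ε hε
  obtain ⟨e, he, heε⟩ : ∃ e : ℝ, 0 < e ∧ ENNReal.ofReal e < ε := by
    obtain ⟨q, hq, hqε⟩ := ENNReal.lt_iff_exists_nnreal_btwn.1 hε
    exact ⟨q, by exact_mod_cast hq, by simpa using hqε⟩
  -- The second bound ensures `B * (C * e₁) ≤ e / 2`; `C + 1` keeps the denominator positive when `C
  -- = 0`.
  set e₁ : ℝ := min e (e / (2 * B * (C + 1))) with he₁
  have he₁pos : 0 < e₁ := by positivity
  obtain ⟨η, hη, hφ⟩ := exists_orderIso_of_displacement (Finset.univ.biUnion D) he₁pos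
  have hmesh : Tendsto (fun k => ((π k).mesh : ℝ)) atTop (𝓝 0) :=
    NNReal.tendsto_coe.2 hπ
  have hsmall : Tendsto (fun k => B * (C * ((π k).mesh : ℝ) + riemannError (π k) f)) atTop
      (𝓝 0) := by
    simpa using ((hmesh.const_mul (C : ℝ)).add (tendsto_riemannError hf hπ)).const_mul B
  have hev := (hmesh.eventually (gt_mem_nhds hη)).and
    (hsmall.eventually (gt_mem_nhds (half_pos he)))
  obtain ⟨k₀, hk₀⟩ := eventually_atTop.1 hev
  refine ⟨k₀, fun k hk => ?_⟩
  obtain ⟨hk1, hk2⟩ := hk₀ k hk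
  obtain ⟨φ, hφD, hφt⟩ := hφ (fun τ => (π k).pt ((π k).upIndex τ)) (π k).pt_upIndex_zero
    (π k).pt_upIndex_one fun τ => ((π k).abs_pt_upIndex_sub_le τ).trans hk1.le
  rw [edist_comm]
  refine lt_of_le_of_lt (iInf_le _ φ) (lt_of_le_of_lt ?_ heε)
  refine max_le (iSup_le fun t => ?_) (iSup_le fun t => ?_)
  · rw [Subtype.edist_eq, edist_dist, Real.dist_eq]
    exact ENNReal.ofReal_le_ofReal ((hφt t).trans (min_le_left _ _))
  · rw [edist_pi_le_iff]
    intro i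
    rw [edist_dist, Real.dist_eq]
    refine ENNReal.ofReal_le_ofReal ?_
    set s := (π k).index (φ t) with hs
    -- Since `φ` sends each jump time to its rounded-up grid point, the step path at `φ t` has seen
    -- exactly the jumps that occurred by time `t`.
    have hn : n i ((π k).pt s) = n i t := by
      refine hD i _ _ fun τ hτ => ?_
      rw [← (π k).pt_upIndex_le_iff, ← hφD τ (Finset.mem_biUnion.2 ⟨i, Finset.mem_univ _, hτ⟩),
        φ.le_iff_le]
    set S : ℝ := ∑ j ∈ Finset.range s, (schedule (π k) f j : ℝ) with hS
    set F : ℝ := ∫ τ in (0 : ℝ)..t, (f τ : ℝ) with hF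
    have hFS : |F - S| ≤ C * (e₁ + (π k).mesh) + riemannError (π k) f := by
      have h1 := hf.abs_integral_sub_le hC ((π k).pt s).2 t.2
      have h2 := abs_sum_schedule_sub_le hf (π k) ((π k).index_le (φ t))
      rw [abs_sub_comm] at h2
      have h3 : |(t : ℝ) - (π k).pt s| ≤ e₁ + (π k).mesh := by
        have h4 := (π k).sub_pt_index_le (φ t)
        have h5 : ((π k).pt s : ℝ) ≤ φ t := (π k).pt_index_le (φ t)
        have h6 := hφt t
        rw [abs_sub_comm] at h6
        have h7 : |(φ t : ℝ) - (π k).pt s| ≤ (π k).mesh := by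
          rw [abs_of_nonneg (by linarith)]; exact h4
        exact (abs_sub_le _ (φ t : ℝ) _).trans (add_le_add h6 h7)
      refine (abs_sub_le _ (∫ τ in (0 : ℝ)..(π k).pt s, (f τ : ℝ)) _).trans (add_le_add ?_ h2)
      exact h1.trans (mul_le_mul_of_nonneg_left h3 (NNReal.coe_nonneg _))
    have hni : (n i t : ℝ) ≤ M := by
      have h1 : (n i t : ℝ) ≤ n i 1 := Nat.cast_le.2 ((n i).mono t.2.2)
      exact h1.trans (Finset.single_le_sum (f := fun i => (n i 1 : ℝ))
        (fun _ _ => Nat.cast_nonneg _) (Finset.mem_univ i))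
    have hval : (solution β₁ hβ₂ hf n) t i
        - ((π k).stepPath fun s i => (β₁ + n i ((π k).pt s)) /
          (β₂ + ∑ j ∈ Finset.range s, (schedule (π k) f j : ℝ))) (φ t) i
        = (β₁ + n i t) * ((β₂ + F)⁻¹ - (β₂ + S)⁻¹) := by
      change A β₂ f t * (β₁ + n i t) - (β₁ + n i ((π k).pt s)) / (β₂ + S) = _
      rw [hn, A]
      ring
    rw [hval, abs_mul, abs_of_nonneg (by positivity)]
    have hF0 : 0 ≤ F := integral_nonneg_of_mem t.2
    have hS0 : 0 ≤ S := by positivity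
    have h1 := abs_inv_sub_inv_le hβ₂ hF0 hS0
    have h2 : B * (C * e₁) ≤ e / 2 := by
      have h3 : e₁ ≤ e / (2 * B * (C + 1)) := min_le_right _ _
      rw [le_div_iff₀ (by positivity)] at h3
      nlinarith [mul_pos hB0 he₁pos]
    calc (β₁ + n i t) * |(β₂ + F)⁻¹ - (β₂ + S)⁻¹|
        ≤ (β₁ + M) * ((β₂ ^ 2)⁻¹ * (C * (e₁ + (π k).mesh) + riemannError (π k) f)) := by
          refine mul_le_mul (by linarith) (h1.trans ?_) (abs_nonneg _) (by positivity)
          exact mul_le_mul_of_nonneg_left hFS (by positivity)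
      _ = B * (C * e₁) + B * (C * (π k).mesh + riemannError (π k) f) := by rw [hB]; ring
      _ ≤ e := by linarith

end GammaPoisson

namespace GammaPoisson

/-! ### Comparison of products of Poisson distributions -/

section PoissonComparison

variable {J : Type*} [Fintype J]

/-- The ratio of the masses at `k` is `exp(-(b - a)) * (b / a) ^ k`, and the power is at least `1`.
-/
lemma ofReal_exp_mul_poissonMeasure_singleton_le {a b : ℝ≥0} (h : a ≤ b) (k : ℕ) :
    ENNReal.ofReal (Real.exp (-((b : ℝ) - a))) * poissonMeasure a {k} ≤ poissonMeasure b {k} := by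
  rw [poissonMeasure_singleton, poissonMeasure_singleton,
    ← ENNReal.ofReal_mul (Real.exp_pos _).le]
  refine ENNReal.ofReal_le_ofReal ?_
  rw [← mul_div_assoc, ← mul_assoc, ← Real.exp_add, show -((b : ℝ) - a) + -a = -b by ring]
  have : (a : ℝ) ≤ b := h
  gcongr

lemma ofReal_exp_mul_pi_poissonMeasure_le {c a : J → ℝ≥0} (h : ∀ j, c j ≤ a j)
    (B : Set (J → ℕ)) :
    ENNReal.ofReal (Real.exp (-∑ j, ((a j : ℝ) - c j)))
        * Measure.pi (fun j => poissonMeasure (c j)) B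
      ≤ Measure.pi (fun j => poissonMeasure (a j)) B := by
  have hB : MeasurableSet B := B.to_countable.measurableSet
  rw [← Measure.tsum_indicator_apply_singleton _ B hB,
    ← Measure.tsum_indicator_apply_singleton _ B hB, ← ENNReal.tsum_mul_left]
  refine ENNReal.tsum_le_tsum fun k => ?_
  by_cases hk : k ∈ B
  · rw [indicator_of_mem hk, indicator_of_mem hk, Measure.pi_singleton, Measure.pi_singleton,
      ← Finset.sum_neg_distrib, Real.exp_sum,
      ENNReal.ofReal_prod_of_nonneg fun _ _ => (Real.exp_pos _).le, ← Finset.prod_mul_distrib]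
    exact Finset.prod_le_prod' fun j _ => ofReal_exp_mul_poissonMeasure_singleton_le (h j) (k j)
  · simp [hk]

/-- Products of Poisson distributions with close rates are close in total variation. -/
lemma pi_poissonMeasure_le_add (a b : J → ℝ≥0) (B : Set (J → ℕ)) :
    Measure.pi (fun j => poissonMeasure (b j)) B
      ≤ Measure.pi (fun j => poissonMeasure (a j)) B
        + ENNReal.ofReal (1 - Real.exp (-∑ j, |(a j : ℝ) - b j|)) := by
  set e : ℝ := Real.exp (-∑ j, |(a j : ℝ) - b j|) with he
  have hB : MeasurableSet B := B.to_countable.measurableSet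
  -- With the smaller rates, `e * Q c` minorizes both `Q a` and `Q b`. Using this for `Q a` on `B`
  -- and for `Q b` on `Bᶜ`, the two lower bounds add up to `e`.
  set c : J → ℝ≥0 := fun j => min (a j) (b j) with hc
  set Q : (J → ℝ≥0) → Measure (J → ℕ) := fun r => Measure.pi fun j => poissonMeasure (r j) with hQ
  have hdom : ∀ r : J → ℝ≥0, (∀ j, c j ≤ r j) → (∀ j, (r j : ℝ) - c j ≤ |(a j : ℝ) - b j|) →
      ∀ s : Set (J → ℕ), e * (Q c).real s ≤ (Q r).real s := by
    intro r h1 h2 s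
    have h := ENNReal.toReal_mono (measure_ne_top _ _) (ofReal_exp_mul_pi_poissonMeasure_le h1 s)
    rw [ENNReal.toReal_mul, ENNReal.toReal_ofReal (Real.exp_pos _).le] at h
    refine le_trans (mul_le_mul_of_nonneg_right ?_ ENNReal.toReal_nonneg) h
    exact Real.exp_le_exp.2 (neg_le_neg (Finset.sum_le_sum fun j _ => h2 j))
  have ha := hdom a (fun j => min_le_left _ _) (fun j => by
    rcases le_total (a j) (b j) with h | h
    · simp [hc, h]
    · simp only [hc, min_eq_right h]; exact le_abs_self _) B
  have hb := hdom b (fun j => min_le_right _ _) (fun j => by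
    rcases le_total (a j) (b j) with h | h
    · simp only [hc, min_eq_left h]; rw [abs_sub_comm]; exact le_abs_self _
    · simp [hc, h]) Bᶜ
  have h1 := probReal_add_probReal_compl (μ := Q b) hB
  have h2 := probReal_add_probReal_compl (μ := Q c) hB
  have h3 : (Q b).real B ≤ (Q a).real B + (1 - e) := by
    have h : e * (Q c).real B + e * (Q c).real Bᶜ = e := by rw [← mul_add, h2, mul_one]
    linarith
  have h4 : ∀ r, Q r B = ENNReal.ofReal ((Q r).real B) := fun r =>
    (ENNReal.ofReal_toReal (measure_ne_top _ _)).symm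
  change Q b B ≤ Q a B + _
  rw [h4 b, h4 a]
  exact (ENNReal.ofReal_le_ofReal h3).trans ENNReal.ofReal_add_le

/-- The unconditional law is a mixture of Poisson products; as `J → ℕ` is countable, the point
masses determine it. -/
lemma CondPoisson.measure_eq {Ω S : Type*} [MeasurableSpace Ω] [MeasurableSpace S]
    {P : Measure Ω} {X : Ω → S} {Z : J → Ω → ℕ} {rate : J → S → ℝ≥0}
    (h : CondPoisson P X Z rate) (hX : Measurable X) (hZ : ∀ j, Measurable (Z j))
    (hrate : ∀ j, Measurable (rate j)) (B : Set (J → ℕ)) :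
    P {ω | (fun j => Z j ω) ∈ B}
      = ∫⁻ x, Measure.pi (fun j => poissonMeasure (rate j x)) B ∂(P.map X) := by
  have hB : MeasurableSet B := B.to_countable.measurableSet
  have hZ' : Measurable fun ω j => Z j ω := measurable_pi_lambda _ hZ
  have hm : ∀ k : J → ℕ, Measurable fun x => ∏ j, poissonMeasure (rate j x) {k j} := by
    intro k
    refine Finset.measurable_prod _ fun j _ => ?_
    simp only [poissonMeasure_singleton]
    have := hrate j
    fun_prop
  have hpt : ∀ k : J → ℕ, P.map (fun ω j => Z j ω) {k}
      = ∫⁻ x, ∏ j, poissonMeasure (rate j x) {k j} ∂(P.map X) := by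
    intro k
    rw [Measure.map_apply hZ' (measurableSet_singleton k), lintegral_map (hm k) hX]
    have := h univ MeasurableSet.univ k
    simp only [preimage_univ, univ_inter, Measure.restrict_univ] at this
    rw [← this]
    congr 1
    ext ω
    simp [funext_iff]
  change P ((fun ω j => Z j ω) ⁻¹' B) = _
  rw [← Measure.map_apply hZ' hB, ← Measure.tsum_indicator_apply_singleton _ B hB]
  have hrhs : ∀ x, Measure.pi (fun j => poissonMeasure (rate j x)) B
      = ∑' k, B.indicator (fun k => ∏ j, poissonMeasure (rate j x) {k j}) k := by
    intro x
    rw [← Measure.tsum_indicator_apply_singleton _ B hB]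
    simp only [Measure.pi_singleton]
  simp only [hrhs]
  rw [lintegral_tsum]
  · refine tsum_congr fun k => ?_
    by_cases hk : k ∈ B
    · simp only [indicator_of_mem hk, hpt]
    · simp [hk]
  · intro k
    by_cases hk : k ∈ B
    · simpa only [indicator_of_mem hk] using (hm k).aemeasurable
    · simp [hk]

end PoissonComparison

/-! ### Comparison of the observations with the increments of the Cox process -/

/-- The increments along a partition of a vector of counting paths. -/
def increment {d : ℕ} (π : UnitPartition) (n : Fin d → CountingPath) (j : Fin π.T × Fin d) : ℕ :=
  n j.2 (π.pt (j.1 + 1)) - n j.2 (π.pt j.1)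

/-- Both families are mixtures over the same `p`, so it suffices to compare the Poisson products for
fixed `x`; summing the rate differences over cells and coordinates factors as the Riemann error
times `∑ x_i`. -/
lemma measure_increment_le {d : ℕ} {g : ℝ → ℝ≥0} {p : Measure (Fin d → ℝ≥0)} {π : UnitPartition}
    {Ω : Type*} [MeasurableSpace Ω] {P : Measure Ω} {X : Ω → Fin d → ℝ≥0} {Y : Ω → ℕ → Fin d → ℕ}
    (hY : IsObservationModel P p π.T (schedule π g) X Y)
    {Ω' : Type*} [MeasurableSpace Ω'] {P' : Measure Ω'} {X' : Ω' → Fin d → ℝ≥0}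
    (hX' : P'.map X' = p) {N : Ω' → Fin d → CountingPath} (hN : IsCoxProcess P' X' g N)
    (B : Set (Fin π.T × Fin d → ℕ)) :
    P' {ω | increment π (N ω) ∈ B} ≤ P {ω | (fun j : Fin π.T × Fin d => Y ω j.1 j.2) ∈ B}
      + ∫⁻ x, ENNReal.ofReal (1 - Real.exp (-(riemannError π g * ∑ i, (x i : ℝ)))) ∂p := by
  have hmono : Monotone fun j : Fin (π.T + 1) => π.pt j := fun r s h =>
    π.pt_le_pt h (Nat.lt_succ_iff.1 s.2)
  have hinc : CondPoisson P' X' (fun (j : Fin π.T × Fin d) ω => increment π (N ω) j)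
      (fun j x => x j.2 * (∫ τ in (π.pt j.1 : ℝ)..π.pt (j.1 + 1), (g τ : ℝ)).toNNReal) := by
    simpa [increment] using hN.increments π.T (fun j => π.pt j) hmono
  have h1 := hinc.measure_eq hN.measurable_X
    (fun j => (hN.measurable_N _ _).sub (hN.measurable_N _ _))
    (fun j => ((measurable_pi_apply j.2).mul_const _)) B
  have h2 := hY.cond.measure_eq hY.measurable_X (fun j => hY.measurable_Y _ j.1.2 _)
    (fun j => ((measurable_pi_apply j.2).const_mul _)) B
  rw [hX'] at h1
  rw [hY.law_X] at h2
  rw [h1, h2, ← lintegral_add_right _ (by fun_prop)]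
  refine lintegral_mono fun x => ?_
  refine (pi_poissonMeasure_le_add (fun j => schedule π g j.1 * x j.2) _ B).trans (le_of_eq ?_)
  congr 5
  rw [Fintype.sum_prod_type, riemannError, Finset.sum_mul, ← Fin.sum_univ_eq_sum_range
    (fun s => |(schedule π g s : ℝ) - ∫ τ in (π.pt s : ℝ)..π.pt (s + 1), (g τ : ℝ)|
      * ∑ i, (x i : ℝ))]
  refine Finset.sum_congr rfl fun s _ => ?_
  rw [Finset.mul_sum]
  refine Finset.sum_congr rfl fun i _ => ?_
  have hnn : 0 ≤ ∫ τ in (π.pt s : ℝ)..π.pt (s + 1), (g τ : ℝ) :=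
    intervalIntegral.integral_nonneg (π.pt_le_pt (Nat.le_succ s) s.2) fun _ _ => NNReal.coe_nonneg _
  simp only [NNReal.coe_mul, Real.coe_toNNReal _ hnn]
  rw [mul_comm (x i : ℝ), ← sub_mul, abs_mul, NNReal.abs_eq]

/-- The integrand is at most `1`, so finiteness of `p` alone provides the dominating function. -/
lemma tendsto_lintegral_one_sub_exp {d : ℕ} (p : Measure (Fin d → ℝ≥0)) [IsFiniteMeasure p]
    {e : ℕ → ℝ} (he : Tendsto e atTop (𝓝 0)) :
    Tendsto (fun n => ∫⁻ x, ENNReal.ofReal (1 - Real.exp (-(e n * ∑ i, (x i : ℝ)))) ∂p) atTop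
      (𝓝 0) := by
  have h := tendsto_lintegral_of_dominated_convergence (μ := p)
    (F := fun n x => ENNReal.ofReal (1 - Real.exp (-(e n * ∑ i, (x i : ℝ)))))
    (f := fun _ => 0) (fun _ => 1) (fun n => by fun_prop)
    (fun n => ae_of_all _ fun x => by
      rw [ENNReal.ofReal_le_one]
      have := Real.exp_pos (-(e n * ∑ i, (x i : ℝ)))
      linarith) (by simp) (ae_of_all _ fun x => ?_)
  · simpa using h
  · have h1 : Tendsto (fun n => 1 - Real.exp (-(e n * ∑ i, (x i : ℝ)))) atTop (𝓝 0) := by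
      have h2 : Continuous fun u : ℝ => 1 - Real.exp (-(u * ∑ i, (x i : ℝ))) := by fun_prop
      simpa [Function.comp_def] using (h2.tendsto 0).comp he
    simpa [Function.comp_def] using (ENNReal.continuous_ofReal.tendsto 0).comp h1

/-! ### The recursion as a function of the observations -/

lemma posteriorMean_eq {d : ℕ} {β₁ β₂ : ℝ} (hβ₂ : 0 < β₂) (α : ℕ → ℝ≥0) (y : ℕ → Fin d → ℕ)
    (s : ℕ) (i : Fin d) :
    posteriorMean β₁ β₂ α y s i = (β₁ + ∑ k ∈ Finset.range s, (y k i : ℝ))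
      / (β₂ + ∑ k ∈ Finset.range s, (α k : ℝ)) := by
  induction s with
  | zero => simp [posteriorMean]
  | succ s ih =>
    have h1 : 0 < β₂ + ∑ k ∈ Finset.range s, (α k : ℝ) := by positivity
    have h2 : 0 < β₂ + ∑ k ∈ Finset.range (s + 1), (α k : ℝ) := by positivity
    simp only [posteriorMean]
    rw [ih, Finset.sum_range_succ (fun k => (y k i : ℝ))]
    field_simp
    ring

lemma UnitPartition.stepPath_congr {E : Type*} [TopologicalSpace E] (π : UnitPartition)
    {m m' : ℕ → E} (h : ∀ s ≤ π.T, m s = m' s) : π.stepPath m = π.stepPath m' := by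
  ext u
  exact h _ (π.index_le u)

/-- The path of the recursion as a function of the finitely many observations. -/
noncomputable def recursionPath {d : ℕ} (β₁ β₂ : ℝ) (f : ℝ → ℝ≥0) (π : UnitPartition)
    (y : Fin π.T × Fin d → ℕ) : SkorokhodSpace (Fin d → ℝ) :=
  π.stepPath (posteriorMean β₁ β₂ (schedule π f)
    -- The value `0` beyond the last observation never enters the path, which stops at index `T`.
    fun s i => if h : s < π.T then y (⟨s, h⟩, i) else 0)

/-- The observations form a countable discrete space, so nothing about the Borel structure of the
Skorokhod space is needed. -/
lemma measurable_recursionPath {d : ℕ} (β₁ β₂ : ℝ) (f : ℝ → ℝ≥0) (π : UnitPartition) :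
    Measurable (recursionPath (d := d) β₁ β₂ f π) :=
  measurable_of_countable _

lemma recursionPath_observations {d : ℕ} {β₁ β₂ : ℝ} (hβ₂ : 0 < β₂) (f : ℝ → ℝ≥0)
    (π : UnitPartition) (y : ℕ → Fin d → ℕ) :
    recursionPath β₁ β₂ f π (fun j => y j.1 j.2)
      = π.stepPath (posteriorMean β₁ β₂ (schedule π f) y) := by
  refine π.stepPath_congr fun s hs => ?_
  ext i
  rw [posteriorMean_eq hβ₂, posteriorMean_eq hβ₂]
  congr 2
  refine Finset.sum_congr rfl fun k hk => ?_
  rw [dif_pos ((Finset.mem_range.1 hk).trans_le hs)]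

lemma recursionPath_increment {d : ℕ} {β₁ β₂ : ℝ} (hβ₂ : 0 < β₂) (f : ℝ → ℝ≥0)
    (π : UnitPartition) (n : Fin d → CountingPath) :
    recursionPath β₁ β₂ f π (increment π n)
      = π.stepPath fun s i =>
        (β₁ + n i (π.pt s)) / (β₂ + ∑ j ∈ Finset.range s, (schedule π f j : ℝ)) := by
  refine π.stepPath_congr fun s hs => ?_
  ext i
  rw [posteriorMean_eq hβ₂]
  congr 2
  have h : ∀ k ∈ Finset.range s,
      ((if h : k < π.T then increment π n (⟨k, h⟩, i) else 0 : ℕ) : ℝ)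
        = n i (π.pt (k + 1)) - n i (π.pt k) := by
    intro k hk
    have hk' : k < π.T := (Finset.mem_range.1 hk).trans_le hs
    rw [dif_pos hk', increment, Nat.cast_sub ((n i).mono (π.pt_le_pt (Nat.le_succ k) hk'))]
  rw [Finset.sum_congr rfl h, Finset.sum_range_sub (fun k => (n i (π.pt k) : ℝ)), π.pt_zero,
    (n i).zero]
  simp

/-! ### Convergence in distribution by comparison -/

/-- If `W n → Z` pointwise and the laws of `Z n` dominate those of `W n` up to an error which
vanishes uniformly over open sets, then `Z n → Z` in distribution. -/
lemma tendstoInDistribution_of_le_add {E : Type*} [PseudoEMetricSpace E] [MeasurableSpace E]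
    [BorelSpace E] {Ω : ℕ → Type*} [∀ n, MeasurableSpace (Ω n)] {P : ∀ n, Measure (Ω n)}
    [∀ n, IsProbabilityMeasure (P n)] {Ω' : Type*} [MeasurableSpace Ω'] {P' : Measure Ω'}
    [IsProbabilityMeasure P'] {V : ∀ n, Ω n → E} {W : ℕ → Ω' → E} {Z : Ω' → E}
    (hV : ∀ n, Measurable (V n)) (hW : ∀ n, Measurable (W n))
    (hlim : ∀ ω, Tendsto (fun n => W n ω) atTop (𝓝 (Z ω))) {r : ℕ → ℝ≥0∞}
    (hr : Tendsto r atTop (𝓝 0))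
    (hle : ∀ n (G : Set E), P' (W n ⁻¹' G) ≤ P n (V n ⁻¹' G) + r n) :
    TendstoInDistribution V atTop Z P P' := by
  -- Measurability of the limit is inherited from the approximations.
  have hZ : Measurable Z := measurable_of_tendsto_metrizable hW (tendsto_pi_nhds.2 hlim)
  refine ⟨fun n => (hV n).aemeasurable, hZ.aemeasurable, ?_⟩
  refine tendsto_of_forall_isOpen_le_liminf_nat' fun G hG => ?_
  change P'.map Z G ≤ liminf (fun n => (P n).map (V n) G) atTop
  have hGm := hG.measurableSet
  rw [Measure.map_apply hZ hGm]
  simp only [fun n => Measure.map_apply (μ := P n) (hV n) hGm]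
  calc P' (Z ⁻¹' G) = ∫⁻ ω, (Z ⁻¹' G).indicator (1 : Ω' → ℝ≥0∞) ω ∂P' :=
        (lintegral_indicator_one (hZ hGm)).symm
    _ ≤ ∫⁻ ω, liminf (fun n => (W n ⁻¹' G).indicator (1 : Ω' → ℝ≥0∞) ω) atTop ∂P' := by
        refine lintegral_mono fun ω => ?_
        -- If `Z ω` lies in the open set `G`, then so does `W n ω` eventually; this pointwise bound
        -- feeds Fatou's lemma.
        by_cases h : Z ω ∈ G
        · have hev : ∀ᶠ n in atTop, (W n ⁻¹' G).indicator (1 : Ω' → ℝ≥0∞) ω = 1 := by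
            filter_upwards [(hlim ω).eventually (hG.mem_nhds h)] with n hn
            simp [show W n ω ∈ G from hn]
          rw [liminf_congr hev]
          simp [h]
        · simp [h]
    _ ≤ liminf (fun n => ∫⁻ ω, (W n ⁻¹' G).indicator (1 : Ω' → ℝ≥0∞) ω ∂P') atTop :=
        lintegral_liminf_le fun n =>
          Measurable.indicator (measurable_const (a := (1 : ℝ≥0∞))) (hW n hGm)
    _ = liminf (fun n => P' (W n ⁻¹' G)) atTop := by
        simp only [fun n => lintegral_indicator_one (μ := P') (hW n hGm)]
    _ ≤ liminf (fun n => P n (V n ⁻¹' G) + r n) atTop :=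
        liminf_le_liminf (.of_forall fun n => hle n G)
    _ = liminf (fun n => P n (V n ⁻¹' G)) atTop := ENNReal.liminf_add_of_right_tendsto_zero hr _

end GammaPoisson

/-! ### Assembly: existence, uniqueness and convergence -/

open GammaPoisson in
theorem theorem3 {d : ℕ} (β₁ β₂ : ℝ) (hβ₁ : 0 < β₁) (hβ₂ : 0 < β₂)
    (f : ℝ → ℝ≥0) (hf : RiemannIntegrable f)
    (g : ℝ → ℝ≥0) (hg : g = f ∨ g = fun _ => 1)
    (p : Measure (Fin d → ℝ≥0)) [IsProbabilityMeasure p]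
    (π : ℕ → UnitPartition) (hπ : Tendsto (fun n => (π n).mesh) atTop (𝓝 0))
    {Ω : ℕ → Type*} [∀ n, MeasurableSpace (Ω n)]
    (P : ∀ n, Measure (Ω n)) [∀ n, IsProbabilityMeasure (P n)]
    (X : ∀ n, Ω n → Fin d → ℝ≥0) (Y : ∀ n, Ω n → ℕ → Fin d → ℕ)
    (hY : ∀ n, IsObservationModel (P n) p (π n).T (schedule (π n) g) (X n) (Y n))
    {Ω' : Type*} [MeasurableSpace Ω'] (P' : Measure Ω') [IsProbabilityMeasure P']
    (X' : Ω' → Fin d → ℝ≥0) (hX' : P'.map X' = p)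
    (N : Ω' → Fin d → CountingPath) (hN : IsCoxProcess P' X' g N) :
    ∃ μ : Ω' → SkorokhodSpace (Fin d → ℝ),
      (∀ᵐ ω ∂P', SolvesSDE β₁ β₂ f (N ω) (μ ω)) ∧
      (∀ ν : Ω' → SkorokhodSpace (Fin d → ℝ),
        (∀ᵐ ω ∂P', SolvesSDE β₁ β₂ f (N ω) (ν ω)) → ν =ᵐ[P'] μ) ∧
      TendstoInDistribution
        (fun n ω => (π n).stepPath (posteriorMean β₁ β₂ (schedule (π n) f) (Y n ω)))
        atTop μ P P' := by
  -- Both observation models enter only through the Riemann integrability of `g`.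
  have hg' : RiemannIntegrable g := by
    rcases hg with rfl | rfl
    exacts [hf, RiemannIntegrable.const 1]
  refine ⟨fun ω => solution β₁ hβ₂ hf (N ω), ae_of_all _ fun ω => solution_solvesSDE hβ₂ hf (N ω),
    fun ν hν => hν.mono fun ω hω => hω.unique hβ₂ hf (solution_solvesSDE hβ₂ hf (N ω)), ?_⟩
  have hV : ∀ n ω, (π n).stepPath (posteriorMean β₁ β₂ (schedule (π n) f) (Y n ω))
      = recursionPath β₁ β₂ f (π n) fun j => Y n ω j.1 j.2 := fun n ω =>
    (recursionPath_observations hβ₂ f (π n) (Y n ω)).symm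
  simp only [hV]
  refine tendstoInDistribution_of_le_add
    (W := fun n ω => recursionPath β₁ β₂ f (π n) (increment (π n) (N ω)))
    (fun n => (measurable_recursionPath β₁ β₂ f (π n)).comp
      (measurable_pi_lambda _ fun j => (hY n).measurable_Y _ j.1.2 _))
    (fun n => (measurable_recursionPath β₁ β₂ f (π n)).comp
      (measurable_pi_lambda _ fun j => (hN.measurable_N _ _).sub (hN.measurable_N _ _)))
    (fun ω => ?_)
    (tendsto_lintegral_one_sub_exp p (tendsto_riemannError hg' hπ))
    (fun n G => measure_increment_le (hY n) hX' hN (recursionPath β₁ β₂ f (π n) ⁻¹' G))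
  simp only [recursionPath_increment hβ₂]
  exact tendsto_stepPath_solution hβ₁ hβ₂ hf hπ (N ω)
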